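/- Let $N,n,n_0\ge 1$, $A\in\mathbb R^{n\times n}$ and $C_i\in\mathbb R^{m_i\times n}$, $i=1,\dots,N$, be such that the pair $(C,A)$ with $C=\mathrm{col}(C_1,\dots,C_N)$ is observable, i.e. the matrix $\mathrm{col}(C,CA,\dots,CA^{n-1})$ has rank $n$. For each $i$ let $U_i\in\mathbb R^{n\times\nu_i}$ be a matrix whose columns form an orthonormal basis of the unobservable subspace $\ker\,\mathrm{col}(C_i,C_iA,\dots,C_iA^{n-1})$ of $(C_i,A)$, put $\nu=\sum_{i=1}^N\nu_i$ and $U=\text{block diag}\{U_1,\dots,U_N\}\in\mathbb R^{Nn\times\nu}$. For $p=1,\dots,n_0$ let $\mathcal G_p$ be an undirected graph on the nodes $\{1,\dots,N\}$ without self-loops, with a symmetric nonnegative weighted adjacency matrix $[a^p_{ij}]$ such that $a^p_{ii}=0$ and, for $i\ne j$, $a^p_{ij}>0$ if and only if $(j,i)$ is an edge of $\mathcal G_p$, and let $\mathcal L_p$ be its Laplacian, with diagonal entries $\sum_{j}a^p_{ij}$ and off-diagonal entries $-a^p_{ij}$. Let $\sigma:[0,\infty)\to\{1,\dots,n_0\}$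 be a piecewise constant switching signal with switching instants $0=t_0<t_1<t_2<\cdots$ and dwell time $\tau>0$, i.e. $t_{j+1}-t_j\ge\tau$ and $\sigma$ is constant on $[t_j,t_{j+1})$ for every $j\ge 0$. Suppose that the switching graph is jointly connected: there are a subsequence $\{t_{j_k}\}_{k\ge 0}$ of the switching instants with $t_{j_0}=0$ and a constant $T_c>0$ such that, for every $k\ge 0$, $\tau\le t_{j_{k+1}}-t_{j_k}\le T_c$ and the union graph $\bigcup_{t_j\in[t_{j_k},t_{j_{k+1}})}\mathcal G_{\sigma(t_j)}$ is connected. Then, for every symmetric positive definite matrix $Q\in\mathbb R^{\nu\times\nu}$, the linear switched system $$\dot\eta(t)=-Q\,U^{T}\left(\mathcal L_{\sigma(t)}\otimes I_n\right)U\,\eta(t),\qquad t\ge 0,$$ is exponentially stable: there are constants $c,r>0$ such that, for every $t^*\ge 0$, every solution $\eta$ on $[t^*,\infty)$ satisfies $\|\eta(t)\|\le c\,e^{-r(t-t^*)}\|\eta(t^*)\|$ for all $t\ge t^*$, where $\|\cdot\|$ is the Euclidean norm. -/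

import Mathlib

open scoped Matrix Kronecker

/-- `σ : [0, ∞) → {1, …, n₀}` is a piecewise constant switching signal with switching instants
`t 0 = 0 < t 1 < t 2 < ⋯` and dwell time `τ > 0`.  (Values of `σ` at negative times are never
used.) -/
structure IsSwitchingSignal {n₀ : ℕ} (σ : ℝ → Fin n₀) (t : ℕ → ℝ) (τ : ℝ) : Prop where
  dwell_pos : 0 < τ
  start : t 0 = 0
  dwell : ∀ j, τ ≤ t (j + 1) - t j
  const : ∀ j, ∃ p, ∀ s ∈ Set.Ico (t j) (t (j + 1)), σ s = p

/-- `a` is a weighted adjacency matrix of the undirected graph `G`: a nonnegative symmetric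
matrix with zero diagonal, whose off-diagonal entry `a i j` is positive exactly when there is an
edge from `j` to `i`. -/
structure IsWeightedAdjacency {N : ℕ} (G : SimpleGraph (Fin N)) (a : Matrix (Fin N) (Fin N) ℝ) :
    Prop where
  nonneg : ∀ i j, 0 ≤ a i j
  symm : a.IsSymm
  diag_zero : ∀ i, a i i = 0
  pos_iff : ∀ i j, i ≠ j → (0 < a i j ↔ G.Adj j i)

/-- The Laplacian of a weighted adjacency matrix: `l i i = ∑ k, a i k`, and `l i j = - a i j`
for `i ≠ j`. -/
def weightedLaplacian {N : ℕ} (a : Matrix (Fin N) (Fin N) ℝ) : Matrix (Fin N) (Fin N) ℝ :=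
  Matrix.of fun i j => if i = j then ∑ k, a i k else - a i j

/-- The jointly connected condition for the switching graph `G (σ s)` with switching instants `t`
and dwell time `τ`: along a subsequence `t (j k)` of the switching instants that starts at `0` and
whose gaps lie in `[τ, Tc]`, the union of the graphs over each `[t (j k), t (j (k + 1)))` is
connected. -/
def JointlyConnected {n₀ N : ℕ} (G : Fin n₀ → SimpleGraph (Fin N)) (σ : ℝ → Fin n₀) (t : ℕ → ℝ)
    (τ : ℝ) : Prop :=
  ∃ (j : ℕ → ℕ) (Tc : ℝ), StrictMono j ∧ t (j 0) = 0 ∧ 0 < Tc ∧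
    ∀ k, τ ≤ t (j (k + 1)) - t (j k) ∧ t (j (k + 1)) - t (j k) ≤ Tc ∧
      (⨆ r ∈ {r : ℕ | t r ∈ Set.Ico (t (j k)) (t (j (k + 1)))}, G (σ (t r))).Connected

/-- The observability matrix `col (C, C A, …, C A ^ (n - 1))`. -/
def observabilityMatrix {ι : Type*} {n : ℕ} (C : Matrix ι (Fin n) ℝ)
    (A : Matrix (Fin n) (Fin n) ℝ) : Matrix (Fin n × ι) (Fin n) ℝ :=
  Matrix.of fun p c => (C * A ^ (p.1 : ℕ)) p.2 c

/-- The pair `(C, A)` is observable: its observability matrix has rank `n`. -/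
def IsObservable {ι : Type*} {n : ℕ} (C : Matrix ι (Fin n) ℝ)
    (A : Matrix (Fin n) (Fin n) ℝ) : Prop :=
  (observabilityMatrix C A).rank = n

/-- The stacked output matrix `col (C 1, …, C N)`. -/
def stackedOutput {N n : ℕ} {m : Fin N → ℕ} (C : ∀ i, Matrix (Fin (m i)) (Fin n) ℝ) :
    Matrix (Σ i, Fin (m i)) (Fin n) ℝ :=
  Matrix.of fun p c => C p.1 p.2 c

/-- The columns of `U` form an orthonormal basis of the unobservable subspace of `(C, A)`, the
kernel of the observability matrix. -/
def IsUnobservableBasis {m n ν : ℕ} (C : Matrix (Fin m) (Fin n) ℝ) (A : Matrix (Fin n) (Fin n) ℝ)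
    (U : Matrix (Fin n) (Fin ν) ℝ) : Prop :=
  Uᵀ * U = 1 ∧
    LinearMap.range U.mulVecLin = LinearMap.ker (observabilityMatrix C A).mulVecLin

/-- `block diag (U 1, …, U N)`, an `(N n) × ν` matrix with `ν = ∑ i, ν i`. -/
def blockDiag {N n : ℕ} {ν : Fin N → ℕ} (U : ∀ i, Matrix (Fin n) (Fin (ν i)) ℝ) :
    Matrix (Fin N × Fin n) (Σ i, Fin (ν i)) ℝ :=
  (Matrix.blockDiagonal' U).submatrix (fun p => ⟨p.1, p.2⟩) id

/-- `η` is a (Carathéodory) solution on `[t₀, ∞)` of the linear time-varying system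
`η' (s) = M s η (s)`. -/
def IsLTVSolution {ι : Type*} [Fintype ι] (M : ℝ → Matrix ι ι ℝ) (t₀ : ℝ)
    (η : ℝ → EuclideanSpace ℝ ι) : Prop :=
  ∀ t, t₀ ≤ t →
    IntervalIntegrable (fun s => WithLp.toLp 2 (M s *ᵥ (η s).ofLp) : ℝ → EuclideanSpace ℝ ι)
      MeasureTheory.volume t₀ t ∧
    η t = η t₀ + ∫ s in t₀..t, (WithLp.toLp 2 (M s *ᵥ (η s).ofLp) : EuclideanSpace ℝ ι)

/-- The linear time-varying system `η' (s) = M s η (s)`, `s ≥ 0`, is (uniformly) exponentially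
stable, with the Euclidean norm on the state space. -/
def ExponentiallyStable {ι : Type*} [Fintype ι] (M : ℝ → Matrix ι ι ℝ) : Prop :=
  ∃ c > 0, ∃ r > 0, ∀ t₀ ≥ 0, ∀ η : ℝ → EuclideanSpace ℝ ι, IsLTVSolution M t₀ η →
    ∀ t ≥ t₀, ‖η t‖ ≤ c * Real.exp (-r * (t - t₀)) * ‖η t₀‖

section Primitive

open MeasureTheory Set Filter Topology

variable {E : Type*} [NormedAddCommGroup E] [NormedSpace ℝ E] {f η : ℝ → E} {t₀ : ℝ}

theorem continuousOn_Ici_of_eq_integral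
    (h : ∀ t, t₀ ≤ t → IntervalIntegrable f volume t₀ t ∧ η t = η t₀ + ∫ s in t₀..t, f s) :
    ContinuousOn η (Ici t₀) := by
  intro x hx
  have hx' : t₀ ≤ x := hx
  have hc := intervalIntegral.continuousOn_primitive_interval' (h (x + 1) (by linarith)).1
    (a := t₀) left_mem_uIcc
  rw [uIcc_of_le (by linarith)] at hc
  have h1 : ContinuousOn η (Icc t₀ (x + 1)) :=
    (continuousOn_const.add hc).congr fun s hs => (h s hs.1).2
  refine (h1 x ⟨hx', by linarith⟩).mono_of_mem_nhdsWithin ?_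
  rw [← Ici_inter_Iic]
  exact inter_mem self_mem_nhdsWithin (mem_nhdsWithin_of_mem_nhds (Iic_mem_nhds (by linarith)))

theorem intervalIntegrable_of_eq_integral
    (h : ∀ t, t₀ ≤ t → IntervalIntegrable f volume t₀ t ∧ η t = η t₀ + ∫ s in t₀..t, f s)
    {a b : ℝ} (ha : t₀ ≤ a) (hb : t₀ ≤ b) : IntervalIntegrable f volume a b :=
  (h a ha).1.symm.trans (h b hb).1

theorem sub_eq_integral_of_eq_integral
    (h : ∀ t, t₀ ≤ t → IntervalIntegrable f volume t₀ t ∧ η t = η t₀ + ∫ s in t₀..t, f s)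
    {a b : ℝ} (ha : t₀ ≤ a) (hb : t₀ ≤ b) : η b - η a = ∫ s in a..b, f s := by
  rw [(h a ha).2, (h b hb).2, ← intervalIntegral.integral_interval_sub_left (h b hb).1 (h a ha).1]
  abel

theorem hasDerivWithinAt_Ioi_of_eq_integral [CompleteSpace E]
    (h : ∀ t, t₀ ≤ t → IntervalIntegrable f volume t₀ t ∧ η t = η t₀ + ∫ s in t₀..t, f s)
    {x : ℝ} (hx : t₀ ≤ x) (hf : ContinuousWithinAt f (Ioi x) x) :
    HasDerivWithinAt η (f x) (Ioi x) x := by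
  have hm : StronglyMeasurableAtFilter f (𝓝[Ioi x] x) volume := by
    refine ⟨Ioc x (x + 1), Ioc_mem_nhdsGT (by linarith), ?_⟩
    exact (intervalIntegrable_of_eq_integral h hx (b := x + 1)
      (by linarith)).1.aestronglyMeasurable
  have hd := intervalIntegral.integral_hasDerivWithinAt_right (h x hx).1 (s := Ici x)
    (t := Ioi x) hm hf
  refine ((hd.mono Ioi_subset_Ici_self).const_add (η t₀)).congr (fun s hs => ?_) (h x hx).2
  exact (h s (hx.trans (le_of_lt hs))).2

theorem sq_integral_le_mul_integral_sq {g : ℝ → ℝ} {a b : ℝ} (hab : a < b)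
    (hg : IntervalIntegrable g volume a b)
    (hg2 : IntervalIntegrable (fun s => g s ^ 2) volume a b) :
    (∫ s in a..b, g s) ^ 2 ≤ (b - a) * ∫ s in a..b, g s ^ 2 := by
  set I := ∫ s in a..b, g s with hI
  have hpos : 0 < b - a := sub_pos.2 hab
  set c := I / (b - a) with hc
  have h1 : ∫ s in a..b, (2 * c * g s - c ^ 2) ≤ ∫ s in a..b, g s ^ 2 := by
    refine intervalIntegral.integral_mono_on hab.le
      ((hg.const_mul _).sub intervalIntegrable_const) hg2 fun s _ => ?_
    nlinarith [sq_nonneg (g s - c)]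
  rw [intervalIntegral.integral_sub (hg.const_mul _) intervalIntegrable_const,
    intervalIntegral.integral_const_mul, intervalIntegral.integral_const, smul_eq_mul, ← hI] at h1
  have h2 : I = c * (b - a) := by rw [hc]; field_simp
  have h3 : 2 * c * I - (b - a) * c ^ 2 = (b - a) * c ^ 2 := by rw [h2]; ring
  calc I ^ 2 = (b - a) * ((b - a) * c ^ 2) := by rw [h2]; ring
    _ ≤ _ := by
      rw [← h3]; exact mul_le_mul_of_nonneg_left h1 hpos.le

end Primitive

theorem exists_joint_antilipschitz {κ E : Type*} [NormedAddCommGroup E] [NormedSpace ℝ E]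
    [FiniteDimensional ℝ E] [Finite κ] (B : κ → E →L[ℝ] E) :
    ∃ L > 0, ∀ S : Set κ, (∀ x, (∀ p ∈ S, B p x = 0) → x = 0) →
      ∀ x δ, 0 ≤ δ → (∀ p ∈ S, ‖B p x‖ ≤ δ) → ‖x‖ ≤ L * δ := by
  classical
  have := Fintype.ofFinite κ
  have key : ∀ S : Set κ, ∃ L : ℝ, (∀ x, (∀ p ∈ S, B p x = 0) → x = 0) →
      ∀ x δ, 0 ≤ δ → (∀ p ∈ S, ‖B p x‖ ≤ δ) → ‖x‖ ≤ L * δ := by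
    intro S
    by_cases hS : ∀ x, (∀ p ∈ S, B p x = 0) → x = 0
    · have hker : (LinearMap.pi fun p : S => (B p : E →ₗ[ℝ] E)).ker = ⊥ := by
        rw [LinearMap.ker_eq_bot']
        intro x hx
        exact hS x fun p hp => congrFun hx ⟨p, hp⟩
      obtain ⟨L, -, hL⟩ := LinearMap.exists_antilipschitzWith _ hker
      refine ⟨L, fun _ x δ hδ hx => ?_⟩
      refine (hL.le_mul_norm (map_zero _) x).trans ?_
      gcongr
      exact (pi_norm_le_iff_of_nonneg hδ).2 fun p => hx p p.2
    · exact ⟨0, fun h => absurd h hS⟩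
  choose L hL using key
  obtain ⟨M, hM⟩ := Finset.exists_le (Finset.univ.image L)
  refine ⟨max M 1, by positivity, fun S hS x δ hδ hx => (hL S hS x δ hδ hx).trans ?_⟩
  gcongr
  exact (hM _ (Finset.mem_image_of_mem _ (Finset.mem_univ S))).trans (le_max_left _ _)

theorem exp_decay_of_contraction {V : ℝ → ℝ} {ρ T t₀ : ℝ} (hρ : 0 < ρ) (hρ1 : ρ < 1) (hT : 0 < T)
    (hV : ∀ a b, t₀ ≤ a → a ≤ b → V b ≤ V a) (hV0 : 0 ≤ V t₀)
    (hc : ∀ a, t₀ ≤ a → V (a + T) ≤ ρ * V a) {t : ℝ} (ht : t₀ ≤ t) :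
    V t ≤ ρ⁻¹ * Real.exp (-(-Real.log ρ / T) * (t - t₀)) * V t₀ := by
  have hi : ∀ i : ℕ, V (t₀ + i * T) ≤ ρ ^ i * V t₀ := by
    intro i
    induction i with
    | zero => simp
    | succ i ih =>
      have h1 := hc (t₀ + i * T) (by nlinarith [mul_nonneg i.cast_nonneg hT.le])
      calc V (t₀ + (i + 1 : ℕ) * T) = V (t₀ + i * T + T) := by push_cast; ring_nf
        _ ≤ ρ * V (t₀ + i * T) := h1
        _ ≤ ρ * (ρ ^ i * V t₀) := by gcongr
        _ = _ := by ring
  have hx0 : 0 ≤ (t - t₀) / T := div_nonneg (by linarith) hT.le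
  set i := ⌊(t - t₀) / T⌋₊
  have h1 : (i : ℝ) ≤ (t - t₀) / T := Nat.floor_le hx0
  have h2 : (t - t₀) / T < i + 1 := Nat.lt_floor_add_one _
  have h3 : i * T ≤ t - t₀ := (le_div_iff₀ hT).1 h1
  refine (hV _ t (by nlinarith [mul_nonneg i.cast_nonneg hT.le]) (by linarith)).trans
    ((hi i).trans ?_)
  gcongr
  have hlog : Real.log ρ < 0 := Real.log_neg hρ hρ1
  rw [← Real.rpow_natCast, Real.rpow_def_of_pos hρ, ← Real.exp_log (inv_pos.2 hρ), Real.log_inv,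
    ← Real.exp_add]
  apply Real.exp_le_exp.2
  have : -(-Real.log ρ / T) * (t - t₀) = Real.log ρ * ((t - t₀) / T) := by ring
  rw [this]
  nlinarith

section Switched

open MeasureTheory Set Filter Topology

variable {κ E : Type*} [NormedAddCommGroup E] [InnerProductSpace ℝ E] [CompleteSpace E]
  {F B : κ → E →L[ℝ] E} {R : E →L[ℝ] E} {σ : ℝ → κ} {η : ℝ → E} {t₀ : ℝ}

/-- Energy balance for a switched linear system `η' = F (σ s) η` with storage function `‖R η‖ ^ 2`
and dissipation `‖B (σ s) η‖ ^ 2`. -/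
theorem energy_balance
    (hR : ∀ p x, inner ℝ (R x) (R (F p x)) = -‖B p x‖ ^ 2)
    (hσ : ∀ x, t₀ ≤ x → ∃ y, x < y ∧ ∀ s ∈ Ico x y, σ s = σ x)
    (h : ∀ t, t₀ ≤ t → IntervalIntegrable (fun s => F (σ s) (η s)) volume t₀ t ∧
      η t = η t₀ + ∫ s in t₀..t, F (σ s) (η s))
    {a b : ℝ} (ha : t₀ ≤ a) (hab : a ≤ b) :
    IntervalIntegrable (fun s => ‖B (σ s) (η s)‖ ^ 2) volume a b ∧
      ‖R (η a)‖ ^ 2 - ‖R (η b)‖ ^ 2 = 2 * ∫ s in a..b, ‖B (σ s) (η s)‖ ^ 2 := by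
  have hcont := continuousOn_Ici_of_eq_integral h
  have hder : ∀ x, t₀ ≤ x → HasDerivWithinAt η (F (σ x) (η x)) (Ioi x) x := by
    intro x hx
    refine hasDerivWithinAt_Ioi_of_eq_integral h hx ?_
    obtain ⟨y, hxy, hy⟩ := hσ x hx
    have h1 : ContinuousWithinAt (fun s => F (σ x) (η s)) (Ioi x) x :=
      (F (σ x)).continuous.continuousAt.comp_continuousWithinAt
        ((hcont x hx).mono fun s hs => hx.trans (le_of_lt hs))
    refine h1.congr_of_eventuallyEq ?_ rfl
    filter_upwards [Ioo_mem_nhdsGT hxy] with s hs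
    rw [hy s ⟨hs.1.le, hs.2⟩]
  have hder2 : ∀ x, t₀ ≤ x → HasDerivWithinAt (fun s => -(‖R (η s)‖ ^ 2) / 2)
      (‖B (σ x) (η x)‖ ^ 2) (Ioi x) x := by
    intro x hx
    have h1 := (R.hasFDerivAt.comp_hasDerivWithinAt x (hder x hx)).norm_sq
    simp only [Function.comp_apply, hR] at h1
    exact ((h1.neg).div_const 2).congr_deriv (by ring)
  have hc2 : ContinuousOn (fun s => -(‖R (η s)‖ ^ 2) / 2) (Icc a b) :=
    (((R.continuous.comp_continuousOn (hcont.mono fun s hs => ha.trans hs.1)).norm.pow 2).neg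
      ).div_const 2
  have hint : IntervalIntegrable (fun s => ‖B (σ s) (η s)‖ ^ 2) volume a b := by
    rw [intervalIntegrable_iff_integrableOn_Ioc_of_le hab]
    exact intervalIntegral.integrableOn_deriv_right_of_nonneg hc2
      (fun x hx => hder2 x (ha.trans hx.1.le)) fun x _ => sq_nonneg _
  refine ⟨hint, ?_⟩
  rw [intervalIntegral.integral_eq_sub_of_hasDeriv_right (f := fun s => -(‖R (η s)‖ ^ 2) / 2)
    (by rwa [uIcc_of_le hab])
    (fun x hx => hder2 x (ha.trans (by rw [min_eq_left hab] at hx; exact hx.1.le))) hint]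
  ring

/-- Over a window on which the dissipations of the active modes are jointly coercive, the storage
function dissipates a definite fraction of the initial state. -/
theorem norm_sq_le_mul_dissipated
    (hR : ∀ p x, inner ℝ (R x) (R (F p x)) = -‖B p x‖ ^ 2)
    (hσ : ∀ x, t₀ ≤ x → ∃ y, x < y ∧ ∀ s ∈ Ico x y, σ s = σ x)
    (h : ∀ t, t₀ ≤ t → IntervalIntegrable (fun s => F (σ s) (η s)) volume t₀ t ∧
      η t = η t₀ + ∫ s in t₀..t, F (σ s) (η s))
    {K τ T : ℝ} (hτ : 0 < τ)
    (hF : ∀ p x, ‖F p x‖ ≤ K * ‖B p x‖) (hB : ∀ p x, ‖B p x‖ ≤ K * ‖x‖)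
    {a b : ℝ} (ha : t₀ ≤ a) (hab : a < b) (hT : b - a ≤ T)
    {c : ℝ} (hac : a ≤ c) (hcb : c + τ ≤ b) {p : κ} (hp : ∀ s ∈ Ico c (c + τ), σ s = p) :
    ‖B p (η a)‖ ^ 2 ≤ (1 / τ + K ^ 4 * T) * (‖R (η a)‖ ^ 2 - ‖R (η b)‖ ^ 2) := by
  obtain ⟨hi, hD⟩ := energy_balance hR hσ h ha hab.le
  set D := ‖R (η a)‖ ^ 2 - ‖R (η b)‖ ^ 2 with hDdef
  have hJ0 : 0 ≤ ∫ s in a..b, ‖B (σ s) (η s)‖ ^ 2 :=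
    intervalIntegral.integral_nonneg hab.le fun s _ => sq_nonneg _
  have hT0 : 0 ≤ T := (sub_nonneg.2 hab.le).trans hT
  have hsub : ∀ s ∈ Icc a b, ‖η s - η a‖ ^ 2 ≤ T * K ^ 2 * (D / 2) := by
    intro s hs
    rcases hs.1.eq_or_lt with rfl | has
    · rw [sub_self, norm_zero, zero_pow two_ne_zero]
      have : 0 ≤ D := by rw [hD]; positivity
      positivity
    have hs0 : t₀ ≤ s := ha.trans hs.1
    have hFi := intervalIntegrable_of_eq_integral h ha hs0
    have hBi := (energy_balance hR hσ h ha hs.1).1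
    have hsq : ∀ r, ‖F (σ r) (η r)‖ ^ 2 ≤ K ^ 2 * ‖B (σ r) (η r)‖ ^ 2 := fun r => by
      rw [← mul_pow]; exact pow_le_pow_left₀ (norm_nonneg _) (hF _ _) 2
    have hF2 : IntervalIntegrable (fun r => ‖F (σ r) (η r)‖ ^ 2) volume a s := by
      refine (hBi.const_mul (K ^ 2)).mono_fun ?_ ?_
      · exact (hFi.def'.aestronglyMeasurable.norm).pow 2
      · refine Eventually.of_forall fun r => ?_
        simp only [Real.norm_eq_abs]
        exact abs_le_abs_of_nonneg (sq_nonneg _) (hsq r)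
    rw [sub_eq_integral_of_eq_integral h ha hs0]
    calc ‖∫ r in a..s, F (σ r) (η r)‖ ^ 2 ≤ (∫ r in a..s, ‖F (σ r) (η r)‖) ^ 2 :=
          pow_le_pow_left₀ (norm_nonneg _)
            (intervalIntegral.norm_integral_le_integral_norm hs.1) 2
      _ ≤ (s - a) * ∫ r in a..s, ‖F (σ r) (η r)‖ ^ 2 :=
          sq_integral_le_mul_integral_sq has hFi.norm hF2
      _ ≤ T * ∫ r in a..s, K ^ 2 * ‖B (σ r) (η r)‖ ^ 2 := by
          refine mul_le_mul (by linarith [hs.2]) ?_ ?_ hT0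
          · exact intervalIntegral.integral_mono_on hs.1 hF2 (hBi.const_mul _) fun r _ => hsq r
          · exact intervalIntegral.integral_nonneg hs.1 fun r _ => sq_nonneg _
      _ ≤ T * ∫ r in a..b, K ^ 2 * ‖B (σ r) (η r)‖ ^ 2 := by
          refine mul_le_mul_of_nonneg_left ?_ hT0
          exact intervalIntegral.integral_mono_interval le_rfl hs.1 hs.2
            (Eventually.of_forall fun r => by positivity) (hi.const_mul _)
      _ = T * K ^ 2 * (D / 2) := by
          rw [intervalIntegral.integral_const_mul, hD]; ring
  have hcτ : c ≤ c + τ := by linarith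
  have hic : IntervalIntegrable (fun s => ‖B (σ s) (η s)‖ ^ 2) volume c (c + τ) :=
    (energy_balance hR hσ h (ha.trans hac) hcτ).1
  have hpt : ∀ s ∈ Ioo c (c + τ), ‖B p (η a)‖ ^ 2 ≤
      2 * ‖B (σ s) (η s)‖ ^ 2 + K ^ 4 * T * D := by
    intro s hs
    rw [hp s ⟨hs.1.le, hs.2⟩]
    have h1 := hsub s ⟨hac.trans hs.1.le, hs.2.le.trans hcb⟩
    have h2 : ‖B p (η a)‖ ≤ ‖B p (η s)‖ + K * ‖η s - η a‖ := by
      have : B p (η a) = B p (η s) - B p (η s - η a) := by rw [map_sub]; abel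
      rw [this]
      exact (norm_sub_le _ _).trans (by gcongr; exact hB _ _)
    have h3 : K ^ 2 * ‖η s - η a‖ ^ 2 ≤ K ^ 2 * (T * K ^ 2 * (D / 2)) := by gcongr
    calc ‖B p (η a)‖ ^ 2 ≤ (‖B p (η s)‖ + K * ‖η s - η a‖) ^ 2 :=
          pow_le_pow_left₀ (norm_nonneg _) h2 2
      _ ≤ 2 * ‖B p (η s)‖ ^ 2 + 2 * (K ^ 2 * ‖η s - η a‖ ^ 2) := by
          nlinarith [sq_nonneg (‖B p (η s)‖ - K * ‖η s - η a‖)]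
      _ ≤ _ := by linarith
  have hmono := intervalIntegral.integral_mono_on_of_le_Ioo hcτ intervalIntegrable_const
    ((hic.const_mul 2).add intervalIntegrable_const) hpt
  have hsubint : ∫ s in c..c + τ, ‖B (σ s) (η s)‖ ^ 2 ≤ ∫ s in a..b, ‖B (σ s) (η s)‖ ^ 2 :=
    intervalIntegral.integral_mono_interval hac hcτ hcb
      (Eventually.of_forall fun r => sq_nonneg _) hi
  rw [intervalIntegral.integral_add (hic.const_mul 2) intervalIntegrable_const,
    intervalIntegral.integral_const_mul, intervalIntegral.integral_const,
    intervalIntegral.integral_const, smul_eq_mul, smul_eq_mul, add_sub_cancel_left] at hmono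
  have hfin : τ * ‖B p (η a)‖ ^ 2 ≤ D + τ * (K ^ 4 * T * D) := by linarith
  calc ‖B p (η a)‖ ^ 2 = (τ * ‖B p (η a)‖ ^ 2) / τ := by field_simp
    _ ≤ (D + τ * (K ^ 4 * T * D)) / τ := by gcongr
    _ = _ := by field_simp

theorem exp_stable_of_jointly_coercive [FiniteDimensional ℝ E] [Finite κ]
    (hRinj : Function.Injective R)
    (hR : ∀ p x, inner ℝ (R x) (R (F p x)) = -‖B p x‖ ^ 2)
    (hF : ∃ K, ∀ p x, ‖F p x‖ ≤ K * ‖B p x‖)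
    {τ T : ℝ} (hτ : 0 < τ) (hT : 0 < T)
    (hσ : ∀ x, 0 ≤ x → ∃ y, x < y ∧ ∀ s ∈ Ico x y, σ s = σ x)
    (hwin : ∀ x, 0 ≤ x → ∃ a b, x ≤ a ∧ a < b ∧ b - a ≤ T ∧ b ≤ x + 2 * T ∧
      ∀ y, (∀ p c, a ≤ c → c + τ ≤ b → (∀ s ∈ Ico c (c + τ), σ s = p) → B p y = 0) → y = 0) :
    ∃ c > 0, ∃ r > 0, ∀ t₀ ≥ 0, ∀ η : ℝ → E,
      (∀ t, t₀ ≤ t → IntervalIntegrable (fun s => F (σ s) (η s)) volume t₀ t ∧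
        η t = η t₀ + ∫ s in t₀..t, F (σ s) (η s)) →
      ∀ t ≥ t₀, ‖η t‖ ≤ c * Real.exp (-r * (t - t₀)) * ‖η t₀‖ := by
  obtain ⟨K₁, hK₁⟩ := hF
  obtain ⟨K₂, hK₂⟩ : ∃ K₂, ∀ p, ‖B p‖ ≤ K₂ := by
    have := Fintype.ofFinite κ
    obtain ⟨M, hM⟩ := (Set.finite_range fun p => ‖B p‖).bddAbove
    exact ⟨M, fun p => hM ⟨p, rfl⟩⟩
  set K := max (max K₁ K₂) 0
  have hK0 : 0 ≤ K := le_max_right _ _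
  have hFK : ∀ p x, ‖F p x‖ ≤ K * ‖B p x‖ := fun p x => (hK₁ p x).trans <| by
    gcongr; exact (le_max_left _ _).trans (le_max_left _ _)
  have hBK : ∀ p x, ‖B p x‖ ≤ K * ‖x‖ := fun p x => ((B p).le_opNorm x).trans <| by
    gcongr; exact (hK₂ p).trans ((le_max_right _ _).trans (le_max_left _ _))
  obtain ⟨L, hL0, hL⟩ := exists_joint_antilipschitz B
  obtain ⟨α, hα0, hα⟩ := LinearMap.exists_antilipschitzWith (R : E →ₗ[ℝ] E)
    (LinearMap.ker_eq_bot.2 hRinj)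
  have hαR : ∀ x, ‖x‖ ≤ α * ‖R x‖ := fun x => hα.le_mul_norm (map_zero _) x
  set β := ‖R‖ + 1
  have hβ0 : 0 < β := by positivity
  have hβ : ∀ x, ‖R x‖ ≤ β * ‖x‖ := fun x => (R.le_opNorm x).trans <| by
    gcongr; exact le_add_of_nonneg_right zero_le_one
  set C := 1 / τ + K ^ 4 * T
  have hC0 : 0 < C := by positivity
  set W := β ^ 2 * L ^ 2 * C + 1
  have hW1 : 1 < W := lt_add_of_pos_left _ (by positivity)
  have hW0 : 0 < W := zero_lt_one.trans hW1
  set ρ := 1 - 1 / W with hρ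
  have hρ0 : 0 < ρ := sub_pos.2 ((div_lt_one hW0).2 hW1)
  have hρ1 : ρ < 1 := sub_lt_self _ (by positivity)
  set r := -Real.log ρ / (2 * T)
  have hr : 0 < r := div_pos (neg_pos.2 (Real.log_neg hρ0 hρ1)) (by positivity)
  have hα0' : (0 : ℝ) < α := hα0
  refine ⟨α * Real.sqrt ρ⁻¹ * β, by positivity, r / 2, by positivity, ?_⟩
  intro t₀ ht₀ η h t ht
  have hσ' : ∀ x, t₀ ≤ x → ∃ y, x < y ∧ ∀ s ∈ Ico x y, σ s = σ x :=
    fun x hx => hσ x (ht₀.trans hx)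
  have hmono : ∀ a b, t₀ ≤ a → a ≤ b → ‖R (η b)‖ ^ 2 ≤ ‖R (η a)‖ ^ 2 := by
    intro a b ha hab
    have h1 := (energy_balance hR hσ' h ha hab).2
    have h2 : 0 ≤ ∫ s in a..b, ‖B (σ s) (η s)‖ ^ 2 :=
      intervalIntegral.integral_nonneg hab fun s _ => sq_nonneg _
    linarith
  have hcontr : ∀ x, t₀ ≤ x → ‖R (η (x + 2 * T))‖ ^ 2 ≤ ρ * ‖R (η x)‖ ^ 2 := by
    intro x hx
    obtain ⟨a, b, hxa, hab, hbT, hbx, hobs⟩ := hwin x (ht₀.trans hx)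
    set D := ‖R (η a)‖ ^ 2 - ‖R (η b)‖ ^ 2 with hD
    have hD0 : 0 ≤ D := sub_nonneg.2 (hmono a b (hx.trans hxa) hab.le)
    have hη : ‖η a‖ ≤ L * Real.sqrt (C * D) := by
      refine hL {p | ∃ c, a ≤ c ∧ c + τ ≤ b ∧ ∀ s ∈ Ico c (c + τ), σ s = p}
        (fun y hy => hobs y fun p c h1 h2 h3 => hy p ⟨c, h1, h2, h3⟩) _ _ (Real.sqrt_nonneg _) ?_
      rintro p ⟨c, h1, h2, h3⟩
      refine Real.le_sqrt_of_sq_le ?_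
      exact norm_sq_le_mul_dissipated hR hσ' h hτ hFK hBK (hx.trans hxa) hab hbT h1 h2 h3
    have hVa : ‖R (η a)‖ ^ 2 ≤ W * D := by
      calc ‖R (η a)‖ ^ 2 ≤ (β * (L * Real.sqrt (C * D))) ^ 2 := by
            refine pow_le_pow_left₀ (norm_nonneg _) ((hβ _).trans ?_) 2
            gcongr
        _ = β ^ 2 * L ^ 2 * C * D := by
            rw [mul_pow, mul_pow, Real.sq_sqrt (by positivity)]; ring
        _ ≤ W * D := by gcongr; exact le_add_of_nonneg_right zero_le_one
    have hVb : ‖R (η b)‖ ^ 2 ≤ ρ * ‖R (η a)‖ ^ 2 := by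
      have : ‖R (η a)‖ ^ 2 / W ≤ D := by rw [div_le_iff₀ hW0]; linarith
      have h2 : ρ * ‖R (η a)‖ ^ 2 = ‖R (η a)‖ ^ 2 - ‖R (η a)‖ ^ 2 / W := by rw [hρ]; ring
      linarith
    calc ‖R (η (x + 2 * T))‖ ^ 2 ≤ ‖R (η b)‖ ^ 2 :=
          hmono _ _ (hx.trans (hxa.trans hab.le)) hbx
      _ ≤ ρ * ‖R (η a)‖ ^ 2 := hVb
      _ ≤ ρ * ‖R (η x)‖ ^ 2 := by gcongr ρ * ?_; exact hmono _ _ hx hxa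
  have hdec := exp_decay_of_contraction (V := fun s => ‖R (η s)‖ ^ 2) hρ0 hρ1
    (by positivity : 0 < 2 * T) hmono (sq_nonneg _) hcontr ht
  have hRt : ‖R (η t)‖ ≤ Real.sqrt ρ⁻¹ * Real.exp (-(r / 2) * (t - t₀)) * ‖R (η t₀)‖ := by
    refine le_of_sq_le_sq ?_ (by positivity)
    rw [mul_pow, mul_pow, Real.sq_sqrt (by positivity), ← Real.exp_nat_mul]
    have he : ((2 : ℕ) : ℝ) * (-(r / 2) * (t - t₀)) = -r * (t - t₀) := by push_cast; ring
    rwa [he]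
  calc ‖η t‖ ≤ α * ‖R (η t)‖ := hαR _
    _ ≤ α * (Real.sqrt ρ⁻¹ * Real.exp (-(r / 2) * (t - t₀)) * (β * ‖η t₀‖)) := by
        gcongr; exact hRt.trans (by gcongr; exact hβ _)
    _ = _ := by ring

end Switched

section Laplacian

variable {N : ℕ} {G : SimpleGraph (Fin N)} {a : Matrix (Fin N) (Fin N) ℝ}

theorem weightedLaplacian_mulVec (ha : ∀ i, a i i = 0) (y : Fin N → ℝ) (i : Fin N) :
    (weightedLaplacian a *ᵥ y) i = ∑ j, a i j * (y i - y j) := by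
  have h : ∀ j, weightedLaplacian a i j * y j =
      (if i = j then (∑ k, a i k) * y j else 0) - a i j * y j := by
    intro j
    by_cases hij : i = j
    · subst hij; simp [weightedLaplacian, ha]
    · simp [weightedLaplacian, hij]
  simp only [Matrix.mulVec, dotProduct, h, Finset.sum_sub_distrib, Finset.sum_ite_eq,
    Finset.mem_univ, if_true, mul_sub, Finset.sum_mul]

theorem IsWeightedAdjacency.dotProduct_weightedLaplacian (ha : IsWeightedAdjacency G a)
    (y : Fin N → ℝ) :
    2 * (y ⬝ᵥ weightedLaplacian a *ᵥ y) = ∑ i, ∑ j, a i j * (y i - y j) ^ 2 := by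
  have h1 : y ⬝ᵥ weightedLaplacian a *ᵥ y = ∑ i, ∑ j, a i j * (y i * (y i - y j)) := by
    simp only [dotProduct, weightedLaplacian_mulVec ha.diag_zero, Finset.mul_sum]
    exact Finset.sum_congr rfl fun i _ => Finset.sum_congr rfl fun j _ => by ring
  have h2 : y ⬝ᵥ weightedLaplacian a *ᵥ y = ∑ i, ∑ j, a i j * (y j * (y j - y i)) := by
    rw [h1, Finset.sum_comm]
    exact Finset.sum_congr rfl fun i _ => Finset.sum_congr rfl fun j _ => by rw [ha.symm.apply i j]
  rw [two_mul]
  nth_rw 1 [h1]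
  rw [h2, ← Finset.sum_add_distrib]
  refine Finset.sum_congr rfl fun i _ => ?_
  rw [← Finset.sum_add_distrib]
  exact Finset.sum_congr rfl fun j _ => by ring

theorem IsWeightedAdjacency.posSemidef_weightedLaplacian (ha : IsWeightedAdjacency G a) :
    (weightedLaplacian a).PosSemidef := by
  refine .of_dotProduct_mulVec_nonneg ?_ fun y => ?_
  · ext i j
    by_cases hij : i = j
    · subst hij; simp
    · simp [weightedLaplacian, hij, Ne.symm hij, ha.symm.apply i j]
  · have h := ha.dotProduct_weightedLaplacian y
    have h0 : 0 ≤ ∑ i, ∑ j, a i j * (y i - y j) ^ 2 :=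
      Finset.sum_nonneg fun i _ => Finset.sum_nonneg fun j _ =>
        mul_nonneg (ha.nonneg i j) (sq_nonneg _)
    rw [star_trivial]
    linarith

theorem IsWeightedAdjacency.eq_of_adj (ha : IsWeightedAdjacency G a) {y : Fin N → ℝ}
    (hy : weightedLaplacian a *ᵥ y = 0) {i j : Fin N} (hij : G.Adj i j) : y i = y j := by
  have h := ha.dotProduct_weightedLaplacian y
  have hnn : ∀ i j, 0 ≤ a i j * (y i - y j) ^ 2 := fun i j =>
    mul_nonneg (ha.nonneg i j) (sq_nonneg _)
  rw [hy, dotProduct_zero, mul_zero, eq_comm,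
    Finset.sum_eq_zero_iff_of_nonneg fun i _ => Finset.sum_nonneg fun j _ => hnn i j] at h
  have h1 := (Finset.sum_eq_zero_iff_of_nonneg fun j _ => hnn i j).1 (h i (Finset.mem_univ _)) j
    (Finset.mem_univ _)
  have hpos := (ha.pos_iff i j hij.ne).2 hij.symm
  have h2 := (mul_eq_zero.1 h1).resolve_left hpos.ne'
  exact sub_eq_zero.1 (pow_eq_zero_iff two_ne_zero |>.1 h2)

end Laplacian

theorem SimpleGraph.Connected.eq_of_forall_adj_iSup {V ι α : Type*} {G : ι → SimpleGraph V}
    {S : Set ι} (hG : (⨆ r ∈ S, G r).Connected) {f : V → α}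
    (hf : ∀ r ∈ S, ∀ u v, (G r).Adj u v → f u = f v) (u v : V) : f u = f v := by
  obtain ⟨w⟩ := hG.preconnected u v
  induction w with
  | nil => rfl
  | cons hadj _ ih =>
    simp only [SimpleGraph.iSup_adj] at hadj
    obtain ⟨r, hr, h⟩ := hadj
    exact (hf r hr _ _ h).trans ih

theorem IsObservable.eq_zero {ι : Type*} [Finite ι] {n : ℕ} {C : Matrix ι (Fin n) ℝ}
    {A : Matrix (Fin n) (Fin n) ℝ} (h : IsObservable C A) {w : Fin n → ℝ}
    (hw : ∀ k < n, (C * A ^ k) *ᵥ w = 0) : w = 0 := by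
  have h1 := LinearMap.finrank_range_add_finrank_ker (observabilityMatrix C A).mulVecLin
  have h2 : Module.finrank ℝ (observabilityMatrix C A).mulVecLin.range = n := h
  rw [h2, Module.finrank_fin_fun] at h1
  have h3 : (observabilityMatrix C A).mulVecLin.ker = ⊥ :=
    Submodule.finrank_eq_zero.1 (by omega)
  refine LinearMap.ker_eq_bot'.1 h3 w ?_
  ext ⟨k, i⟩
  exact congrFun (hw k k.2) i

theorem blockDiag_mulVec {N n : ℕ} {ν : Fin N → ℕ} (U : ∀ i, Matrix (Fin n) (Fin (ν i)) ℝ)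
    (x : (Σ i, Fin (ν i)) → ℝ) (i : Fin N) (c : Fin n) :
    (blockDiag U *ᵥ x) (i, c) = (U i *ᵥ fun l => x ⟨i, l⟩) c := by
  simp only [Matrix.mulVec, dotProduct, Fintype.sum_sigma]
  rw [Finset.sum_eq_single i]
  · simp [blockDiag]
  · intro k _ hk
    refine Finset.sum_eq_zero fun l _ => ?_
    simp [blockDiag, Matrix.blockDiagonal'_apply_ne U c l hk.symm]
  · simp

theorem kronecker_one_mulVec {N n : ℕ} (M : Matrix (Fin N) (Fin N) ℝ) (x : Fin N × Fin n → ℝ)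
    (i : Fin N) (c : Fin n) :
    ((M ⊗ₖ (1 : Matrix (Fin n) (Fin n) ℝ)) *ᵥ x) (i, c) = (M *ᵥ fun k => x (k, c)) i := by
  simp [Matrix.mulVec, dotProduct, Fintype.sum_prod_type, Matrix.kroneckerMap_apply,
    Matrix.one_apply]

theorem eq_zero_of_joint_kernel {N n : ℕ} {m ν : Fin N → ℕ} {A : Matrix (Fin n) (Fin n) ℝ}
    {C : ∀ i, Matrix (Fin (m i)) (Fin n) ℝ} (hobs : IsObservable (stackedOutput C) A)
    {U : ∀ i, Matrix (Fin n) (Fin (ν i)) ℝ} (hU : ∀ i, IsUnobservableBasis (C i) A (U i))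
    {ι : Type*} {S : Set ι} {G : ι → SimpleGraph (Fin N)}
    {a : ι → Matrix (Fin N) (Fin N) ℝ} (ha : ∀ r, IsWeightedAdjacency (G r) (a r))
    (hconn : (⨆ r ∈ S, G r).Connected) {x : (Σ i, Fin (ν i)) → ℝ}
    (hx : ∀ r ∈ S, (weightedLaplacian (a r) ⊗ₖ (1 : Matrix (Fin n) (Fin n) ℝ)) *ᵥ
      (blockDiag U *ᵥ x) = 0) : x = 0 := by
  set z : ∀ i, Fin n → ℝ := fun i => U i *ᵥ fun l => x ⟨i, l⟩ with hz
  have hcons : ∀ i k, z i = z k := by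
    intro i k
    refine hconn.eq_of_forall_adj_iSup (f := z) (fun r hr u v huv => ?_) i k
    ext c
    refine (ha r).eq_of_adj (y := fun i => z i c) ?_ huv
    ext i
    have h := congrFun (hx r hr) (i, c)
    rw [kronecker_one_mulVec] at h
    simp only [blockDiag_mulVec] at h
    exact h
  have hker : ∀ i k, k < n → (C i * A ^ k) *ᵥ z i = 0 := by
    intro i k hk
    have h1 : z i ∈ LinearMap.ker (observabilityMatrix (C i) A).mulVecLin := by
      rw [← (hU i).2]
      exact ⟨_, rfl⟩
    ext l
    exact congrFun (LinearMap.mem_ker.1 h1) (⟨k, hk⟩, l)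
  have hz0 : ∀ i, z i = 0 := by
    intro i
    refine hobs.eq_zero fun k hk => ?_
    ext ⟨i', l⟩
    have h := congrFun (hker i' k hk) l
    rw [hcons i' i] at h
    exact h
  ext ⟨i, l⟩
  have h : (U i)ᵀ *ᵥ (U i *ᵥ fun l => x ⟨i, l⟩) = 0 := by
    have := hz0 i
    simp only [hz] at this
    rw [this, Matrix.mulVec_zero]
  rw [Matrix.mulVec_mulVec, (hU i).1, Matrix.one_mulVec] at h
  exact congrFun h l

section Switching

variable {n₀ : ℕ} {σ : ℝ → Fin n₀} {t : ℕ → ℝ} {τ : ℝ}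

theorem exists_le_lt_succ_of_dwell {s : ℕ → ℝ} (hτ : 0 < τ) (h0 : s 0 = 0)
    (hs : ∀ k, τ ≤ s (k + 1) - s k) {x : ℝ} (hx : 0 ≤ x) : ∃ k, s k ≤ x ∧ x < s (k + 1) := by
  have hlin : ∀ k : ℕ, k * τ ≤ s k := by
    intro k
    induction k with
    | zero => simp [h0]
    | succ k ih => push_cast; linarith [hs k]
  have hex : ∃ k, x < s (k + 1) := by
    obtain ⟨k, hk⟩ := exists_nat_gt (x / τ)
    refine ⟨k, ?_⟩
    have h1 := (div_lt_iff₀ hτ).1 hk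
    have h2 := hlin k
    linarith [hs k]
  classical
  refine ⟨Nat.find hex, ?_, Nat.find_spec hex⟩
  rcases hk : Nat.find hex with _ | k
  · rwa [h0]
  · exact not_lt.1 (Nat.find_min hex (hk ▸ Nat.lt_succ_self k))

theorem IsSwitchingSignal.strictMono (hσ : IsSwitchingSignal σ t τ) : StrictMono t :=
  strictMono_nat_of_lt_succ fun k => by linarith [hσ.dwell k, hσ.dwell_pos]

theorem IsSwitchingSignal.eventually_const (hσ : IsSwitchingSignal σ t τ) {x : ℝ} (hx : 0 ≤ x) :
    ∃ y, x < y ∧ ∀ s ∈ Set.Ico x y, σ s = σ x := by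
  obtain ⟨k, hk, hk'⟩ := exists_le_lt_succ_of_dwell hσ.dwell_pos hσ.start hσ.dwell hx
  obtain ⟨p, hp⟩ := hσ.const k
  exact ⟨t (k + 1), hk', fun s hs =>
    (hp s ⟨hk.trans hs.1, hs.2⟩).trans (hp x ⟨hk, hk'⟩).symm⟩

end Switching

theorem Matrix.inner_toEuclideanCLM_toEuclideanCLM {ι : Type*} [Fintype ι] [DecidableEq ι]
    (M : Matrix ι ι ℝ)
    (x y : EuclideanSpace ℝ ι) :
    inner ℝ (Matrix.toEuclideanCLM (𝕜 := ℝ) M x) (Matrix.toEuclideanCLM (𝕜 := ℝ) M y) =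
      inner ℝ x (Matrix.toEuclideanCLM (𝕜 := ℝ) (Mᴴ * M) y) := by
  rw [← Matrix.star_eq_conjTranspose, map_mul, map_star, ContinuousLinearMap.star_eq_adjoint,
    mul_apply_eq_comp, ContinuousLinearMap.adjoint_inner_right]

open scoped MatrixOrder in
theorem Matrix.PosSemidef.exists_eq_conjTranspose_mul_self {ι : Type*} [Fintype ι]
    {M : Matrix ι ι ℝ} (hM : M.PosSemidef) : ∃ B : Matrix ι ι ℝ, M = Bᴴ * B := by
  classical
  exact CStarAlgebra.nonneg_iff_eq_star_mul_self.mp hM.nonneg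

/-- Exponential stability of `η' = -Q H (σ s) η` for positive definite `Q` and positive
semidefinite `H p`, when over windows of bounded length the kernels of the active `H p`
intersect trivially. -/
theorem exponentiallyStable_of_posSemidef {ι κ : Type*} [Fintype ι] [DecidableEq ι] [Finite κ]
    {Q : Matrix ι ι ℝ} (hQ : Q.PosDef) {H : κ → Matrix ι ι ℝ} (hH : ∀ p, (H p).PosSemidef)
    {σ : ℝ → κ} {τ T : ℝ} (hτ : 0 < τ) (hT : 0 < T)
    (hσ : ∀ x, 0 ≤ x → ∃ y, x < y ∧ ∀ s ∈ Set.Ico x y, σ s = σ x)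
    (hwin : ∀ x, 0 ≤ x → ∃ a b, x ≤ a ∧ a < b ∧ b - a ≤ T ∧ b ≤ x + 2 * T ∧
      ∀ y, (∀ p c, a ≤ c → c + τ ≤ b → (∀ s ∈ Set.Ico c (c + τ), σ s = p) → H p *ᵥ y = 0) →
        y = 0) :
    ExponentiallyStable fun s => -(Q * H (σ s)) := by
  obtain ⟨R, hR⟩ := hQ.inv.posSemidef.exists_eq_conjTranspose_mul_self
  choose B hB using fun p => (hH p).exists_eq_conjTranspose_mul_self
  have hdet : IsUnit Q.det := Q.isUnit_iff_isUnit_det.1 hQ.isUnit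
  refine exp_stable_of_jointly_coercive
    (F := fun p => Matrix.toEuclideanCLM (𝕜 := ℝ) (-(Q * H p)))
    (B := fun p => Matrix.toEuclideanCLM (𝕜 := ℝ) (B p))
    (R := Matrix.toEuclideanCLM (𝕜 := ℝ) R) ?_ ?_ ?_ hτ hT hσ ?_
  · refine (injective_iff_map_eq_zero _).2 fun x hx => ?_
    have h1 : Matrix.toEuclideanCLM (𝕜 := ℝ) (Q * (Rᴴ * R)) x = 0 := by
      rw [map_mul, map_mul, mul_apply_eq_comp, mul_apply_eq_comp, hx,
        map_zero, map_zero]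
    rwa [← hR, Matrix.mul_nonsing_inv _ hdet, map_one, one_apply_eq_self] at h1
  · intro p x
    rw [Matrix.inner_toEuclideanCLM_toEuclideanCLM, ← real_inner_self_eq_norm_sq,
      Matrix.inner_toEuclideanCLM_toEuclideanCLM, ← hB, ← hR,
      ← mul_apply_eq_comp, ← map_mul, Matrix.mul_neg,
      Matrix.nonsing_inv_mul_cancel_left _ _ hdet, map_neg, neg_apply,
      inner_neg_right]
  · obtain ⟨K, hK⟩ := (Set.finite_range fun p =>
      ‖Matrix.toEuclideanCLM (𝕜 := ℝ) (-(Q * (B p)ᴴ))‖).bddAbove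
    refine ⟨K, fun p x => ?_⟩
    have h1 : -(Q * H p) = -(Q * (B p)ᴴ) * B p := by
      rw [hB, Matrix.neg_mul, Matrix.mul_assoc]
    rw [h1, map_mul, mul_apply_eq_comp]
    refine (ContinuousLinearMap.le_opNorm _ _).trans ?_
    gcongr
    exact hK ⟨p, rfl⟩
  · intro x hx
    obtain ⟨a, b, h1, h2, h3, h4, h5⟩ := hwin x hx
    refine ⟨a, b, h1, h2, h3, h4, fun y hy => ?_⟩
    refine (WithLp.ofLp_eq_zero 2).1 (h5 y.ofLp fun p c ha hb hc => ?_)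
    have h6 := congrArg WithLp.ofLp (hy p c ha hb hc)
    rw [Matrix.ofLp_toEuclideanCLM] at h6
    rw [hB, ← Matrix.mulVec_mulVec, h6, WithLp.ofLp_zero, Matrix.mulVec_zero]

theorem lemma2 {N n n₀ : ℕ} {m ν : Fin N → ℕ}
    (A : Matrix (Fin n) (Fin n) ℝ)
    (C : ∀ i, Matrix (Fin (m i)) (Fin n) ℝ)
    (hobs : IsObservable (stackedOutput C) A)
    (G : Fin n₀ → SimpleGraph (Fin N))
    (a : Fin n₀ → Matrix (Fin N) (Fin N) ℝ)
    (ha : ∀ p, IsWeightedAdjacency (G p) (a p))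
    (σ : ℝ → Fin n₀) (t : ℕ → ℝ) (τ : ℝ)
    (hσ : IsSwitchingSignal σ t τ)
    (hconn : JointlyConnected G σ t τ)
    (U : ∀ i, Matrix (Fin n) (Fin (ν i)) ℝ)
    (hU : ∀ i, IsUnobservableBasis (C i) A (U i))
    (Q : Matrix (Σ i, Fin (ν i)) (Σ i, Fin (ν i)) ℝ)
    (hQ : Q.PosDef) :
    ExponentiallyStable fun s =>
      -(Q * (blockDiag U)ᵀ *
        (weightedLaplacian (a (σ s)) ⊗ₖ (1 : Matrix (Fin n) (Fin n) ℝ)) * blockDiag U) := by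
  have hL : ∀ p, (weightedLaplacian (a p) ⊗ₖ (1 : Matrix (Fin n) (Fin n) ℝ)).PosSemidef :=
    fun p => (ha p).posSemidef_weightedLaplacian.kronecker Matrix.PosSemidef.one
  set H : Fin n₀ → Matrix (Σ i, Fin (ν i)) (Σ i, Fin (ν i)) ℝ := fun p =>
    (blockDiag U)ᴴ * (weightedLaplacian (a p) ⊗ₖ (1 : Matrix (Fin n) (Fin n) ℝ)) * blockDiag U
    with hHdef
  have hH : ∀ p, (H p).PosSemidef := fun p => (hL p).conjTranspose_mul_mul_same _
  have hker : ∀ p x, H p *ᵥ x = 0 →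
      (weightedLaplacian (a p) ⊗ₖ (1 : Matrix (Fin n) (Fin n) ℝ)) *ᵥ (blockDiag U *ᵥ x) = 0 := by
    intro p x hx
    refine ((hL p).dotProduct_mulVec_zero_iff _).1 ?_
    have h := congrArg (x ⬝ᵥ ·) hx
    simp only [hHdef, Matrix.conjTranspose_eq_transpose_of_trivial, ← Matrix.mulVec_mulVec,
      dotProduct_zero] at h
    rwa [Matrix.dotProduct_mulVec x, Matrix.vecMul_transpose] at h
  obtain ⟨j, Tc, hj, hj0, hTc, hjk⟩ := hconn
  have hmono := hσ.strictMono
  have hstab := exponentiallyStable_of_posSemidef hQ hH (σ := σ) hσ.dwell_pos hTc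
    (fun x hx => hσ.eventually_const hx) ?_
  · simpa only [hHdef, Matrix.conjTranspose_eq_transpose_of_trivial, Matrix.mul_assoc] using hstab
  intro x hx
  obtain ⟨k, hk1, hk2⟩ : ∃ k, x ≤ t (j k) ∧ t (j k) ≤ x + Tc := by
    obtain ⟨k, hk, hk'⟩ := exists_le_lt_succ_of_dwell (s := fun k => t (j k)) hσ.dwell_pos hj0
      (fun k => (hjk k).1) hx
    exact ⟨k + 1, hk'.le, by linarith [(hjk k).2.1]⟩
  obtain ⟨h1, h2, hc⟩ := hjk k
  refine ⟨t (j k), t (j (k + 1)), hk1, hmono (hj k.lt_succ_self), h2, by linarith, fun y hy => ?_⟩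
  refine eq_zero_of_joint_kernel hobs hU (fun r => ha (σ (t r))) hc fun r hr => ?_
  refine hker _ _ (hy _ (t r) hr.1 ?_ fun s hs => ?_)
  · have h3 : r + 1 ≤ j (k + 1) := hmono.lt_iff_lt.1 hr.2
    linarith [hmono.monotone h3, hσ.dwell r]
  · obtain ⟨p, hp⟩ := hσ.const r
    have h4 := hσ.dwell r
    rw [hp s ⟨hs.1, by linarith [hs.2]⟩, hp (t r) ⟨le_rfl, hmono r.lt_succ_self⟩]
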